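/- Let $a<0<b$, let $g$ be a real function, real analytic on a neighbourhood of $[a,b]$, with $g(0)=0$ and $g'(0)=1$, and let $G(x)=\int_0^x g(\xi)\,d\xi$. Suppose that, for some $c$, $G(a)=G(b)=c$, that $G(x)<c$ for $a<x<b$, and that $x\,g(x)>0$ for all $x\in(a,b)$, $x\ne 0$. Call the origin an isochronous center of $\ddot x+g(x)=0$ if there is $T$ such that all orbits of $\dot x=y$, $\dot y=-g(x)$ through points sufficiently close to, and different from, the origin are periodic with minimal period $T$. Let $A:[a,b]\to[a,b]$ be the involution given by $A(0)=0$ and, for $x\neq0$, $G(A(x))=G(x)$ and $A(x)\,x<0$. On each of the two branches $x\in[0,b]$ and $x\in[a,0]$, where $G$ is injective, regard $A$ as a function $A=A(G)$ of $G\in[0,c]$. Then, for each of the two branches: (i) the origin is an isochronous center if and only if there is a function $f$, analytic in a neighbourhood of $0$, such that, with $F(G)=\int_0^G f(\tau)\,d\tau$, the function $A(G)$ is differentiable and satisfies $$2G\,\frac{dA}{dG}=A(G)+F(G)$$ for all sufficiently small $G>0$; (ii) $A(0)=0$ and $\lim_{G\to0^+}\dfrac{A(G)^2}{2G}=1$.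 Moreover, if the origin is an isochronous center, then there is one $f$, analytic at every point of $[0,c)$, for which the equation holds on both branches for all $G\in(0,c)$. -/

import Mathlib

open Set Filter Topology

namespace Isochrony

/-- The potential `G(x) = ∫₀ˣ g(ξ) dξ` of the equation `x'' + g(x) = 0`. -/
noncomputable def potential (g : ℝ → ℝ) (x : ℝ) : ℝ := ∫ ξ in (0 : ℝ)..x, g ξ

/-- `a < 0 < b` are the two turning points of energy `c`: `G(a) = G(b) = c`, `G < c` in between,
and `x g(x) > 0` for `a < x < b`, `x ≠ 0`. -/
structure PotentialWell (g : ℝ → ℝ) (a b c : ℝ) : Prop where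
  neg : a < 0
  pos : 0 < b
  left : potential g a = c
  right : potential g b = c
  lt : ∀ x ∈ Ioo a b, potential g x < c
  sign : ∀ x ∈ Ioo a b, x ≠ 0 → 0 < x * g x

/-- `γ = (x, y)` is a solution, defined for all times, of the system `x' = y`, `y' = -g(x)`. -/
def IsSolution (g : ℝ → ℝ) (γ : ℝ → ℝ × ℝ) : Prop :=
  ∀ t, HasDerivAt γ ((γ t).2, -g (γ t).1) t

/-- `T` is the minimal period of `γ`. -/
def HasMinimalPeriod (γ : ℝ → ℝ × ℝ) (T : ℝ) : Prop :=
  IsLeast {s : ℝ | 0 < s ∧ Function.Periodic γ s} T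

/-- The origin is an isochronous center: the orbits through all points close to the origin
(the origin itself excepted) are periodic, with one and the same minimal period. -/
def IsochronousCenter (g : ℝ → ℝ) : Prop :=
  ∃ T : ℝ, ∀ᶠ p in 𝓝[≠] (0 : ℝ × ℝ),
    ∃ γ : ℝ → ℝ × ℝ, IsSolution g γ ∧ γ 0 = p ∧ HasMinimalPeriod γ T

open Classical in
/-- The involution `A` of `[a, b]`: `A(x)` is the point of `[a, b]` with `G(A(x)) = G(x)` and
`A(x) x < 0` when `x ≠ 0`, and `A(0) = 0`. -/
noncomputable def involution (g : ℝ → ℝ) (a b x : ℝ) : ℝ :=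
  if h : ∃ z ∈ Icc a b, potential g z = potential g x ∧ z * x < 0 then h.choose else 0

/-- The involution as a function of `E = G(x)`, on a branch `s` (`[a, 0]` or `[0, b]`) on which
`G` is injective: `E ↦ A(x)`, where `x` is the point of `s` with `G(x) = E`. -/
noncomputable def involutionOfPotential (g : ℝ → ℝ) (a b : ℝ) (s : Set ℝ) (E : ℝ) : ℝ :=
  involution g a b (Function.invFunOn (potential g) s E)

/-- `u` is differentiable at `E` and `2 E u'(E) = u(E) + F(E)`, where `F(E) = ∫₀ᴱ f`. -/
def SolvesODEAt (f u : ℝ → ℝ) (E : ℝ) : Prop :=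
  DifferentiableAt ℝ u E ∧ 2 * E * deriv u E = u E + ∫ τ in (0 : ℝ)..E, f τ

theorem potential_zero (g : ℝ → ℝ) : potential g 0 = 0 := by simp [potential]

theorem hasDerivAt_potential {g : ℝ → ℝ} {a b x : ℝ} (ha : a < 0) (hb : 0 < b)
    (hg : AnalyticOnNhd ℝ g (Icc a b)) (hx : x ∈ Icc a b) :
    HasDerivAt (potential g) (g x) x := by
  have h0 : (0 : ℝ) ∈ Icc a b := ⟨ha.le, hb.le⟩
  have hsub : uIcc 0 x ⊆ Icc a b := uIcc_subset_Icc h0 hx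
  refine intervalIntegral.integral_hasDerivAt_right
    ((hg.continuousOn.mono hsub).intervalIntegrable) ?_ (hg x hx).continuousAt
  have hev : ∀ᶠ y in 𝓝 x, AnalyticAt ℝ g y := (hg x hx).eventually_analyticAt
  obtain ⟨u, hu, huo, hxu⟩ := eventually_nhds_iff.1 hev
  exact ContinuousOn.stronglyMeasurableAtFilter huo
    (fun y hy => (hu y hy).continuousAt.continuousWithinAt) x hxu

theorem strictMonoOn_potential {g : ℝ → ℝ} {a b c : ℝ} (hg : AnalyticOnNhd ℝ g (Icc a b))
    (h : PotentialWell g a b c) : StrictMonoOn (potential g) (Icc 0 b) := by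
  have hd := fun x hx => hasDerivAt_potential (x := x) h.neg h.pos hg hx
  refine strictMonoOn_of_deriv_pos (convex_Icc 0 b)
    (fun x hx => (hd x ⟨h.neg.le.trans hx.1, hx.2⟩).continuousAt.continuousWithinAt) ?_
  intro x hx
  rw [interior_Icc] at hx
  rw [(hd x ⟨h.neg.le.trans hx.1.le, hx.2.le⟩).deriv]
  have := h.sign x ⟨h.neg.trans hx.1, hx.2⟩ hx.1.ne'
  exact (pos_iff_pos_of_mul_pos this).1 hx.1

theorem strictAntiOn_potential {g : ℝ → ℝ} {a b c : ℝ} (hg : AnalyticOnNhd ℝ g (Icc a b))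
    (h : PotentialWell g a b c) : StrictAntiOn (potential g) (Icc a 0) := by
  have hd := fun x hx => hasDerivAt_potential (x := x) h.neg h.pos hg hx
  refine strictAntiOn_of_deriv_neg (convex_Icc a 0)
    (fun x hx => (hd x ⟨hx.1, hx.2.trans h.pos.le⟩).continuousAt.continuousWithinAt) ?_
  intro x hx
  rw [interior_Icc] at hx
  rw [(hd x ⟨hx.1.le, hx.2.le.trans h.pos.le⟩).deriv]
  have := h.sign x ⟨hx.1, hx.2.trans h.pos⟩ hx.2.ne
  exact (neg_iff_neg_of_mul_pos this).1 hx.2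

/-- For `x ≠ 0` in `[a, b]` the point `A(x)` exists and is unique. -/
theorem existsUnique_involution {g : ℝ → ℝ} {a b c x : ℝ} (hg : AnalyticOnNhd ℝ g (Icc a b))
    (h : PotentialWell g a b c) (hx : x ∈ Icc a b) (hx0 : x ≠ 0) :
    ∃! z, z ∈ Icc a b ∧ potential g z = potential g x ∧ z * x < 0 := by
  have hm := strictMonoOn_potential hg h
  have ha := strictAntiOn_potential hg h
  have hc : ContinuousOn (potential g) (Icc a b) := fun y hy =>
    (hasDerivAt_potential h.neg h.pos hg hy).continuousAt.continuousWithinAt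
  rcases lt_or_gt_of_ne hx0 with hneg | hpos
  · have h1 : potential g x ∈ Icc (potential g 0) (potential g b) := by
      refine ⟨ha.antitoneOn ⟨hx.1, hneg.le⟩ ⟨h.neg.le, le_rfl⟩ hneg.le, ?_⟩
      rw [h.right, ← h.left]
      exact ha.antitoneOn ⟨le_rfl, h.neg.le⟩ ⟨hx.1, hneg.le⟩ hx.1
    obtain ⟨z, hz, hzx⟩ := intermediate_value_Icc h.pos.le
      (hc.mono (Icc_subset_Icc_left h.neg.le)) h1
    have hz0 : 0 < z := by
      refine lt_of_le_of_ne hz.1 fun e => ?_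
      have := ha ⟨hx.1, hneg.le⟩ ⟨h.neg.le, le_rfl⟩ hneg
      rw [e, hzx] at this
      exact lt_irrefl _ this
    refine ⟨z, ⟨⟨h.neg.le.trans hz.1, hz.2⟩, hzx, mul_neg_of_pos_of_neg hz0 hneg⟩, ?_⟩
    rintro w ⟨hw, hwx, hw0⟩
    have hw0' : 0 < w := by
      by_contra hcon
      exact absurd (mul_nonneg_of_nonpos_of_nonpos (not_lt.1 hcon) hneg.le) (not_le.2 hw0)
    exact hm.injOn ⟨hw0'.le, hw.2⟩ hz (hwx.trans hzx.symm)
  · have h1 : potential g x ∈ Icc (potential g 0) (potential g a) := by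
      refine ⟨hm.monotoneOn ⟨le_rfl, h.pos.le⟩ ⟨hpos.le, hx.2⟩ hpos.le, ?_⟩
      rw [h.left, ← h.right]
      exact hm.monotoneOn ⟨hpos.le, hx.2⟩ ⟨h.pos.le, le_rfl⟩ hx.2
    obtain ⟨z, hz, hzx⟩ := intermediate_value_Icc' h.neg.le
      (hc.mono (Icc_subset_Icc_right h.pos.le)) h1
    have hz0 : z < 0 := by
      refine lt_of_le_of_ne hz.2 fun e => ?_
      have := hm ⟨le_rfl, h.pos.le⟩ ⟨hpos.le, hx.2⟩ hpos
      rw [← e, hzx] at this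
      exact lt_irrefl _ this
    refine ⟨z, ⟨⟨hz.1, hz.2.trans h.pos.le⟩, hzx, mul_neg_of_neg_of_pos hz0 hpos⟩, ?_⟩
    rintro w ⟨hw, hwx, hw0⟩
    have hw0' : w < 0 := by
      by_contra hcon
      exact absurd (mul_nonneg (not_lt.1 hcon) hpos.le) (not_le.2 hw0)
    exact ha.injOn ⟨hw.1, hw0'.le⟩ hz (hwx.trans hzx.symm)

/-- `involution` has the defining properties of `A` on `[a, b] \ {0}`. -/
theorem involution_spec {g : ℝ → ℝ} {a b c x : ℝ} (hg : AnalyticOnNhd ℝ g (Icc a b))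
    (h : PotentialWell g a b c) (hx : x ∈ Icc a b) (hx0 : x ≠ 0) :
    involution g a b x ∈ Icc a b ∧ potential g (involution g a b x) = potential g x ∧
      involution g a b x * x < 0 := by
  have hex : ∃ z ∈ Icc a b, potential g z = potential g x ∧ z * x < 0 :=
    (existsUnique_involution hg h hx hx0).exists
  rw [involution, dif_pos hex]
  exact hex.choose_spec

theorem involution_zero (g : ℝ → ℝ) (a b : ℝ) : involution g a b 0 = 0 := by
  simp [involution]

end Isochrony

open Isochrony

/-! Near the origin there is an analytic coordinate `x = φ(s)` with `G(φ(s)) = s²/2`, `φ(0) = 0`,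
`φ'(0) = 1` (`exists_analytic_morse_chart`, `exists_energyChart`). The orbit of amplitude `r` is `x
= φ(r sin θ)`, `y = r cos θ`, and `x' = y` gives `dt = φ'(r sin θ) dθ`. Its period is therefore the
integral of `φ'(r sin θ)` over a circle, which sees only the even part of `φ'`. An analytic even
function whose circle averages do not depend on the radius is constant
(`eventually_eq_zero_of_integral_comp_mul_sin`), so the center is isochronous exactly when `φ(s) -
φ(-s) = 2s` (`isochronousCenter_iff`).

In the same coordinate the two branches of the involution are `A = φ(s)` with `s = ±√(2E)`, and `2E
dA/dE - A` becomes `L(s) = s φ'(s) - φ(s)`. This is an analytic function of `E = s²/2` exactly when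
`L` is even, which is again the condition `φ(s) - φ(-s) = 2s` (`legendre_even_iff`). The limit in
(ii) is `(φ(s)/s)² → φ'(0)²`.

For energies up to `c`, both branches are analytic on `(0, c)`. In the isochronous case they differ
by `2√(2E)` near `0`, hence on all of `(0, c)` by the identity theorem. Since `√E` solves the
homogeneous equation `2E y' = y`, one `f` serves both branches. -/

namespace Isochrony

/-! ### Analytic preliminaries and the square-root coordinate at a minimum -/

/-- A function whose derivative is analytic is analytic. -/
theorem analyticAt_of_hasDerivAt {f f' : ℝ → ℝ} {x₀ : ℝ} (hf' : AnalyticAt ℝ f' x₀)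
    (hf : ∀ᶠ x in 𝓝 x₀, HasDerivAt f (f' x) x) : AnalyticAt ℝ f x₀ := by
  obtain ⟨p, hp⟩ := hf'
  have hp' := hasFPowerSeriesAt_iff'.1 hp
  obtain ⟨ε, hε, hball⟩ := Metric.eventually_nhds_iff_ball.1 (hp'.and hf)
  set ρ : ℝ := ε / 2 with hρ
  have hρ0 : 0 < ρ := by positivity
  -- Absolute convergence at `x₀ + ρ` dominates the series of `f'` on the whole ball of radius `ρ`,
  -- so the primitive can be differentiated term by term.
  have hsum : Summable fun n => ρ ^ n * |p.coeff n| := by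
    have h1 := (hball (x₀ + ρ) (by simp [abs_of_pos hρ0]; linarith)).1.summable.abs
    simpa [abs_mul, abs_of_pos hρ0] using h1
  set q : ℕ → ℝ → ℝ := fun n x => (x - x₀) ^ (n + 1) / (n + 1) * p.coeff n with hq
  have hqd : ∀ n x, HasDerivAt (q n) ((x - x₀) ^ n * p.coeff n) x := by
    intro n x
    have h1 := ((((hasDerivAt_id x).sub_const x₀).pow (n + 1)).div_const ((n : ℝ) + 1)).mul_const
      (p.coeff n)
    refine h1.congr_deriv ?_
    have : (n : ℝ) + 1 ≠ 0 := by positivity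
    simp only [id, add_tsub_cancel_right, mul_one]
    push_cast
    field_simp
  have hbd : ∀ n, ∀ x ∈ Metric.ball x₀ ρ, ‖(x - x₀) ^ n * p.coeff n‖ ≤ ρ ^ n * |p.coeff n| := by
    intro n x hx
    rw [norm_mul, norm_pow, Real.norm_eq_abs, Real.norm_eq_abs]
    have : |x - x₀| ≤ ρ := by simpa [Real.dist_eq] using (Metric.mem_ball.1 hx).le
    gcongr
  have hxx : x₀ ∈ Metric.ball x₀ ρ := Metric.mem_ball_self hρ0
  have hq0 : ∀ n, q n x₀ = 0 := fun n => by simp [hq]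
  have hs0 : Summable fun n => q n x₀ := by simp [hq0, summable_zero]
  set F : ℝ → ℝ := fun x => ∑' n, q n x with hF
  have hFd : ∀ x ∈ Metric.ball x₀ ρ, HasDerivAt F (f' x) x := by
    intro x hx
    have h1 := hasDerivAt_tsum_of_isPreconnected hsum Metric.isOpen_ball
      (convex_ball x₀ ρ).isPreconnected (fun n y _ => hqd n y) hbd hxx hs0 hx
    have h2 := (hball x (Metric.ball_subset_ball (by linarith) hx)).1.tsum_eq
    simp only [smul_eq_mul] at h2
    rwa [h2] at h1
  have hFq : ∀ x ∈ Metric.ball x₀ ρ, Summable fun n => q n x := fun x hx =>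
    summable_of_summable_hasDerivAt_of_isPreconnected hsum Metric.isOpen_ball
      (convex_ball x₀ ρ).isPreconnected (fun n y _ => hqd n y) hbd hxx hs0 hx
  set c : ℕ → ℝ := fun n => Nat.casesOn n (f x₀) fun m => p.coeff m / (m + 1) with hc
  refine ⟨FormalMultilinearSeries.ofScalars ℝ c, hasFPowerSeriesAt_iff'.2 ?_⟩
  filter_upwards [Metric.ball_mem_nhds x₀ hρ0] with x hx
  have hconst : f x - F x = f x₀ - F x₀ := by
    refine (convex_ball x₀ ρ).is_const_of_fderivWithin_eq_zero (𝕜 := ℝ)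
      (f := fun y => f y - F y) ?_ ?_ hx hxx
    · intro y hy
      exact (((hball y (Metric.ball_subset_ball (by linarith) hy)).2.sub
        (hFd y hy)).differentiableAt).differentiableWithinAt
    · intro y hy
      rw [fderivWithin_of_isOpen Metric.isOpen_ball hy]
      have := ((hball y (Metric.ball_subset_ball (by linarith) hy)).2.sub (hFd y hy))
      rw [sub_self] at this
      have h3 := this.hasFDerivAt.fderiv
      change fderiv ℝ (f - F) y = 0
      rw [h3]; ext; simp
  have hF0 : F x₀ = 0 := by simp [hF, hq0]
  have hfx : f x = F x + f x₀ := by linarith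
  rw [hfx]
  have h5 : HasSum (fun n => (x - x₀) ^ (n + 1) • c (n + 1)) (F x) := by
    have := (hFq x hx).hasSum
    refine this.congr_fun ?_
    intro n
    simp [hq, hc]; ring
  have h6 := (hasSum_nat_add_iff (f := fun n => (x - x₀) ^ n • c n) 1).1 h5
  simpa [FormalMultilinearSeries.coeff_ofScalars, hc] using h6

/-- An even analytic function is an analytic function of the square of the variable. -/
theorem exists_analyticAt_comp_sq {f : ℝ → ℝ} (hf : AnalyticAt ℝ f 0)
    (heven : ∀ᶠ x in 𝓝 0, f (-x) = f x) :
    ∃ F : ℝ → ℝ, AnalyticAt ℝ F 0 ∧ ∀ᶠ x in 𝓝 0, f x = F (x ^ 2) := by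
  obtain ⟨p, hp⟩ := hf
  have hp' := hasFPowerSeriesAt_iff'.1 hp
  simp only [sub_zero, smul_eq_mul] at hp'
  have hneg : Tendsto (fun x : ℝ => -x) (𝓝 0) (𝓝 0) := by
    simpa using (continuous_neg (G := ℝ)).tendsto 0
  have key : ∀ᶠ x in 𝓝 0, HasSum (fun n => (x ^ 2) ^ n * p.coeff (2 * n)) (f x) := by
    filter_upwards [hp', hneg.eventually hp', heven] with x h1 h2 h3
    have h4 := (h1.add h2).div_const 2
    rw [h3, add_self_div_two] at h4
    have hinj : Function.Injective fun n : ℕ => 2 * n := fun m n h => by simpa using h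
    have h5 : HasSum ((fun n => (x ^ n * p.coeff n + (-x) ^ n * p.coeff n) / 2) ∘
        fun n : ℕ => 2 * n) (f x) := by
      refine (hinj.hasSum_iff ?_).2 h4
      intro n hn
      have : Odd n := by
        rw [← Nat.not_even_iff_odd]
        rintro ⟨m, rfl⟩
        exact hn ⟨m, by simp; ring⟩
      simp [this.neg_pow]
    refine h5.congr_fun ?_
    intro n
    simp [pow_mul]
  obtain ⟨ε, hε, hball⟩ := Metric.eventually_nhds_iff_ball.1 key
  set F : ℝ → ℝ := fun z => ∑' n, z ^ n * p.coeff (2 * n) with hF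
  have hFx : ∀ x ∈ Metric.ball (0 : ℝ) ε, f x = F (x ^ 2) := fun x hx => (hball x hx).tsum_eq.symm
  refine ⟨F, ⟨FormalMultilinearSeries.ofScalars ℝ fun n => p.coeff (2 * n),
    hasFPowerSeriesAt_iff'.2 ?_⟩, eventually_of_mem (Metric.ball_mem_nhds 0 hε) hFx⟩
  -- For `z < 0` the series is not a value of `f`, but its terms have the same absolute values as
  -- those at `√|z|`, so it still converges.
  have hsm : ∀ᶠ z : ℝ in 𝓝 0, √|z| ∈ Metric.ball (0 : ℝ) ε := by
    have : Tendsto (fun z : ℝ => √|z|) (𝓝 0) (𝓝 0) := by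
      have : Continuous fun z : ℝ => √|z| := by fun_prop
      simpa using this.tendsto 0
    exact this.eventually (Metric.ball_mem_nhds 0 hε)
  filter_upwards [hsm] with z hz
  have h1 := (hball _ hz).summable.abs
  have h2 : Summable fun n => z ^ n * p.coeff (2 * n) := by
    refine Summable.of_norm ?_
    simpa [abs_mul, Real.sq_sqrt] using h1
  simpa [FormalMultilinearSeries.coeff_ofScalars] using h2.hasSum

/-- Near a nondegenerate minimum with value zero an analytic function is half a square in a suitable
analytic coordinate. -/
theorem exists_analytic_morse_chart {G g : ℝ → ℝ} (hg : AnalyticAt ℝ g 0) (hg0 : g 0 = 0)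
    (hg1 : deriv g 0 = 1) (hG : ∀ᶠ x in 𝓝 0, HasDerivAt G (g x) x) (hG0 : G 0 = 0) :
    ∃ φ : ℝ → ℝ, AnalyticAt ℝ φ 0 ∧ φ 0 = 0 ∧ deriv φ 0 = 1 ∧
      ∀ᶠ s in 𝓝 0, G (φ s) = s ^ 2 / 2 := by
  have hGa := analyticAt_of_hasDerivAt hg hG
  have hG1 : deriv G 0 = 0 := by rw [hG.self_of_nhds.deriv, hg0]
  have hord : (2 : ℕ) ≤ analyticOrderAt G 0 := by
    rw [natCast_le_analyticOrderAt_iff_iteratedDeriv_eq_zero hGa]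
    intro i hi
    interval_cases i
    · simpa using hG0
    · simpa using hG1
  obtain ⟨k, hk, hGk⟩ := (natCast_le_analyticOrderAt hGa).1 hord
  simp only [sub_zero, smul_eq_mul] at hGk
  -- Differentiating `G = x² k` and dividing by `x` gives `2k + x k' = g/x`, which tends to `g'(0) =
  -- 1`.
  have hk0 : k 0 = 1 / 2 := by
    have hev : ∀ᶠ x in 𝓝[≠] (0 : ℝ), 2 * k x + x * deriv k x = dslope g 0 x := by
      have h1 := (hGk.eventually_nhds.and (hG.and hk.eventually_analyticAt))
      filter_upwards [nhdsWithin_le_nhds h1, self_mem_nhdsWithin] with x hx hx0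
      have hx0 : x ≠ 0 := hx0
      obtain ⟨h2, h3, h4⟩ := hx
      have h5 := ((hasDerivAt_pow 2 x).mul h4.differentiableAt.hasDerivAt)
      have h6 := (h3.congr_of_eventuallyEq (EventuallyEq.symm h2)).unique h5
      rw [dslope_of_ne _ hx0, slope_def_field, hg0, sub_zero, sub_zero, h6]
      field_simp
      push_cast
      ring
    have hl : Tendsto (fun x => 2 * k x + x * deriv k x) (𝓝[≠] 0) (𝓝 (2 * k 0)) := by
      have : ContinuousAt (fun x => 2 * k x + x * deriv k x) 0 :=
        (continuousAt_const.mul hk.continuousAt).add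
          (continuousAt_id.mul hk.deriv.continuousAt)
      simpa [ContinuousAt] using this.tendsto.mono_left nhdsWithin_le_nhds
    have hr : Tendsto (dslope g 0) (𝓝[≠] 0) (𝓝 1) := by
      have : ContinuousAt (dslope g 0) 0 := continuousAt_dslope_same.2 hg.differentiableAt
      simpa [ContinuousAt, hg1] using this.tendsto.mono_left nhdsWithin_le_nhds
    have := tendsto_nhds_unique (hl.congr' hev) hr
    linarith
  -- Here `h²/2 = G` and `h'(0) = 1`; the chart `φ` is the local inverse of `h`.
  set h : ℝ → ℝ := fun x => x * √(2 * k x) with hh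
  have hsa : AnalyticAt ℝ (fun x => √(2 * k x)) 0 := by
    refine ContDiffAt.analyticAt ?_
    refine ContDiffAt.sqrt ?_ (by simp [hk0])
    exact (contDiffAt_const (c := (2 : ℝ))).mul (hk.contDiffAt)
  have hha : AnalyticAt ℝ h 0 := analyticAt_id.mul hsa
  have hh1 : HasDerivAt h 1 0 := by
    have := (hasDerivAt_id (0 : ℝ)).mul hsa.differentiableAt.hasDerivAt
    refine this.congr_deriv ?_
    simp [hk0]
  have hh0 : h 0 = 0 := by simp [hh]
  have hne : deriv h 0 ≠ 0 := by rw [hh1.deriv]; exact one_ne_zero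
  have hφa := hha.analyticAt_localInverse hne
  have hφr := hha.hasStrictDerivAt.eventually_right_inverse hne
  have hφ0 : hha.hasStrictDerivAt.localInverse _ _ _ hne (h 0) = 0 :=
    HasStrictFDerivAt.localInverse_apply_image ..
  have hφd := (hha.hasStrictDerivAt.to_localInverse hne).hasDerivAt.deriv
  generalize hha.hasStrictDerivAt.localInverse _ _ _ hne = φ at hφa hφr hφ0 hφd
  rw [hh0] at hφa hφr hφ0 hφd
  refine ⟨φ, hφa, hφ0, by rw [hφd, hh1.deriv, inv_one], ?_⟩
  have hφt : Tendsto φ (𝓝 0) (𝓝 0) := by simpa [hφ0] using hφa.continuousAt.tendsto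
  have hkp : ∀ᶠ x in 𝓝 0, 0 < k x :=
    hk.continuousAt.eventually (lt_mem_nhds (by rw [hk0]; norm_num))
  filter_upwards [hφr, hφt.eventually hGk, hφt.eventually hkp] with s h1 h2 h3
  have h4 : s ^ 2 = φ s ^ 2 * (2 * k (φ s)) := by
    rw [← Real.sq_sqrt (x := 2 * k (φ s)) (by linarith), ← mul_pow]
    exact congrArg (· ^ 2) h1.symm
  rw [h2, h4]
  ring

/-! ### Uniqueness and time shifts of solutions -/

/-- A solution is determined by its initial value if another solution with that value stays where
the force is analytic. -/
theorem IsSolution.eq_of_apply_zero_eq {g : ℝ → ℝ} {γ₁ γ₂ : ℝ → ℝ × ℝ} (h₁ : IsSolution g γ₁)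
    (h₂ : IsSolution g γ₂) (hg : ∀ t, AnalyticAt ℝ g (γ₁ t).1) (h0 : γ₁ 0 = γ₂ 0) : γ₁ = γ₂ := by
  have hc₁ : Continuous γ₁ := continuous_iff_continuousAt.2 fun t => (h₁ t).continuousAt
  have hc₂ : Continuous γ₂ := continuous_iff_continuousAt.2 fun t => (h₂ t).continuousAt
  have hclosed : IsClosed {t | γ₁ t = γ₂ t} := isClosed_eq hc₁ hc₂
  -- The field is locally Lipschitz at each point of `γ₁`, so agreement at one time spreads to
  -- nearby times; the agreement set is clopen.
  have hopen : IsOpen {t | γ₁ t = γ₂ t} := by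
    rw [isOpen_iff_mem_nhds]
    intro t ht
    have hv : ContDiffAt ℝ 1 (fun p : ℝ × ℝ => (p.2, -g p.1)) (γ₁ t) := by
      refine contDiffAt_snd.prodMk (ContDiffAt.neg ?_)
      exact ContDiffAt.comp (γ₁ t) (hg t).contDiffAt contDiffAt_fst
    obtain ⟨K, U, hU, hL⟩ := hv.exists_lipschitzOnWith
    exact ODE_solution_unique_of_eventually (v := fun _ p => (p.2, -g p.1)) (s := fun _ => U)
      (Eventually.of_forall fun _ => hL)
      ((hc₁.continuousAt.eventually hU).mono fun s hs => ⟨h₁ s, hs⟩)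
      ((hc₂.continuousAt.eventually (by rw [← show γ₁ t = γ₂ t from ht]; exact hU)).mono
        fun s hs => ⟨h₂ s, hs⟩) ht
  have := IsClopen.eq_univ ⟨hclosed, hopen⟩ ⟨0, h0⟩
  funext t
  exact this.ge (mem_univ t)

theorem IsSolution.comp_add_const {g : ℝ → ℝ} {γ : ℝ → ℝ × ℝ} (h : IsSolution g γ) (t₀ : ℝ) :
    IsSolution g fun t => γ (t + t₀) := fun t => (h (t + t₀)).comp_add_const t t₀

theorem HasMinimalPeriod.comp_add_const {γ : ℝ → ℝ × ℝ} {T : ℝ} (h : HasMinimalPeriod γ T)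
    (t₀ : ℝ) : HasMinimalPeriod (fun t => γ (t + t₀)) T := by
  have : {s : ℝ | 0 < s ∧ Function.Periodic (fun t => γ (t + t₀)) s} =
      {s : ℝ | 0 < s ∧ Function.Periodic γ s} := by
    ext s
    refine and_congr_right fun _ => ⟨fun hs t => ?_, fun hs t => ?_⟩
    · have := hs (t - t₀)
      simp only at this
      rwa [sub_add_cancel, sub_add_eq_add_sub, sub_add_cancel] at this
    · have := hs (t + t₀)
      simp only
      rwa [add_right_comm]
  rw [HasMinimalPeriod, this]
  exact h

/-! ### Orbits and periods in the energy chart -/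

/-- An analytic coordinate `x = φ(s)` near the origin in which the potential energy is `s² / 2`. -/
structure EnergyChart (g φ : ℝ → ℝ) (δ : ℝ) : Prop where
  pos : 0 < δ
  zero : φ 0 = 0
  deriv_zero : deriv φ 0 = 1
  analytic : ∀ s ∈ Ioo (-δ) δ, AnalyticAt ℝ φ s
  deriv_pos : ∀ s ∈ Ioo (-δ) δ, 0 < deriv φ s
  analytic_force : ∀ s ∈ Ioo (-δ) δ, AnalyticAt ℝ g (φ s)
  -- The derivative of the relation `G(φ(s)) = s²/2`.
  force : ∀ s ∈ Ioo (-δ) δ, g (φ s) * deriv φ s = s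

/-- The time at which the orbit of amplitude `r` reaches the angle `θ`. -/
noncomputable def transitTime (φ : ℝ → ℝ) (r θ : ℝ) : ℝ :=
  ∫ τ in (0 : ℝ)..θ, deriv φ (r * Real.sin τ)

theorem mul_sin_mem_Ioo {r δ : ℝ} (hr : 0 ≤ r) (hrδ : r < δ) (τ : ℝ) :
    r * Real.sin τ ∈ Ioo (-δ) δ := by
  have h1 := mul_le_mul_of_nonneg_left (Real.sin_le_one τ) hr
  have h2 := mul_le_mul_of_nonneg_left (Real.neg_one_le_sin τ) hr
  constructor <;> linarith

namespace EnergyChart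

variable {g φ : ℝ → ℝ} {δ r : ℝ}

theorem continuous_deriv_mul_sin (h : EnergyChart g φ δ) (hr : 0 ≤ r) (hrδ : r < δ) :
    Continuous fun τ => deriv φ (r * Real.sin τ) := by
  refine continuous_iff_continuousAt.2 fun τ => ?_
  exact ContinuousAt.comp (f := fun τ => r * Real.sin τ)
    (h.analytic _ (mul_sin_mem_Ioo hr hrδ τ)).deriv.continuousAt (by fun_prop)

theorem hasDerivAt_transitTime (h : EnergyChart g φ δ) (hr : 0 ≤ r) (hrδ : r < δ) (θ : ℝ) :
    HasDerivAt (transitTime φ r) (deriv φ (r * Real.sin θ)) θ :=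
  (h.continuous_deriv_mul_sin hr hrδ).integral_hasStrictDerivAt 0 θ |>.hasDerivAt

theorem strictMono_transitTime (h : EnergyChart g φ δ) (hr : 0 ≤ r) (hrδ : r < δ) :
    StrictMono (transitTime φ r) :=
  strictMono_of_deriv_pos fun θ => by
    rw [(h.hasDerivAt_transitTime hr hrδ θ).deriv]
    exact h.deriv_pos _ (mul_sin_mem_Ioo hr hrδ θ)

theorem transitTime_add_two_pi (h : EnergyChart g φ δ) (hr : 0 ≤ r) (hrδ : r < δ) (θ : ℝ) :
    transitTime φ r (θ + 2 * Real.pi) = transitTime φ r θ + transitTime φ r (2 * Real.pi) := by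
  have hc := h.continuous_deriv_mul_sin hr hrδ
  have hp : Function.Periodic (fun τ => deriv φ (r * Real.sin τ)) (2 * Real.pi) := fun τ => by
    simp
  have h1 := hp.intervalIntegral_add_eq θ 0
  rw [zero_add] at h1
  rw [transitTime, transitTime, transitTime, ← h1,
    intervalIntegral.integral_add_adjacent_intervals] <;> exact hc.intervalIntegrable _ _

/-- The integrand is positive and periodic, so time is an increasing bijective function of the
angle. -/
theorem exists_inverse_transitTime (h : EnergyChart g φ δ) (hr : 0 ≤ r) (hrδ : r < δ) :
    ∃ Θ : ℝ → ℝ, StrictMono Θ ∧ Continuous Θ ∧ (∀ t, transitTime φ r (Θ t) = t) ∧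
      ∀ θ, Θ (transitTime φ r θ) = θ := by
  have hc := h.continuous_deriv_mul_sin hr hrδ
  have hp : Function.Periodic (fun τ => deriv φ (r * Real.sin τ)) (2 * Real.pi) := fun τ => by
    simp
  have hpos : ∀ τ, 0 < deriv φ (r * Real.sin τ) := fun τ =>
    h.deriv_pos _ (mul_sin_mem_Ioo hr hrδ τ)
  have hm := h.strictMono_transitTime hr hrδ
  have hcont : Continuous (transitTime φ r) :=
    continuous_iff_continuousAt.2 fun θ => (h.hasDerivAt_transitTime hr hrδ θ).continuousAt
  have hsurj : Function.Surjective (transitTime φ r) :=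
    hcont.surjective
      (hp.tendsto_atTop_intervalIntegral_of_pos'
        (hc.intervalIntegrable _ _) hpos Real.two_pi_pos)
      (hp.tendsto_atBot_intervalIntegral_of_pos'
        (hc.intervalIntegrable _ _) hpos Real.two_pi_pos)
  let e := hm.orderIsoOfSurjective _ hsurj
  exact ⟨e.symm, e.symm.strictMono, e.symm.continuous, fun t => e.apply_symm_apply t,
    fun θ => e.symm_apply_apply θ⟩

/-- The orbits near the origin. -/
theorem exists_orbit (h : EnergyChart g φ δ) (hr : 0 ≤ r) (hrδ : r < δ) :
    ∃ γ : ℝ → ℝ × ℝ, IsSolution g γ ∧ (∀ t, AnalyticAt ℝ g (γ t).1) ∧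
      (∀ θ, γ (transitTime φ r θ) = (φ (r * Real.sin θ), r * Real.cos θ)) ∧
      (0 < r → HasMinimalPeriod γ (transitTime φ r (2 * Real.pi))) := by
  obtain ⟨Θ, hmono, hcont, hr1, hr2⟩ := h.exists_inverse_transitTime hr hrδ
  have hmem := fun t => mul_sin_mem_Ioo hr hrδ (Θ t)
  have hper : ∀ t, Θ (t + transitTime φ r (2 * Real.pi)) = Θ t + 2 * Real.pi := fun t => by
    conv_lhs => rw [← hr1 t, ← h.transitTime_add_two_pi hr hrδ, hr2]
  have h00 : transitTime φ r 0 = 0 := by simp [transitTime]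
  have hΘ0 : Θ 0 = 0 := by conv_lhs => rw [← h00, hr2]
  refine ⟨fun t => (φ (r * Real.sin (Θ t)), r * Real.cos (Θ t)), fun t => ?_,
    fun t => h.analytic_force _ (hmem t), fun θ => by simp [hr2], fun hr0 => ⟨⟨?_, fun t => ?_⟩, ?_⟩⟩
  · have hd := h.deriv_pos _ (hmem t)
    have hΘ : HasDerivAt Θ (deriv φ (r * Real.sin (Θ t)))⁻¹ t :=
      HasDerivAt.of_local_left_inverse hcont.continuousAt (h.hasDerivAt_transitTime hr hrδ (Θ t))
        hd.ne' (Eventually.of_forall hr1)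
    have hs := hΘ.sin.const_mul r
    have h1 := (h.analytic _ (hmem t)).differentiableAt.hasDerivAt.comp t hs
    have h2 := hΘ.cos.const_mul r
    refine (h1.prodMk h2).congr_deriv ?_
    have hf := h.force _ (hmem t)
    refine Prod.ext ?_ ?_
    · simp only
      field_simp
    · simp only
      rw [← sub_eq_zero]
      field_simp
      linarith
  · rw [← h00]
    exact h.strictMono_transitTime hr hrδ Real.two_pi_pos
  · simp [hper]
  -- After a period `s > 0` the second coordinate is back at its maximum `r`, so `cos (Θ s) = 1` and
  -- `Θ s` is a positive multiple of `2π`.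
  · rintro s ⟨hs0, hs⟩
    have h1 := congrArg Prod.snd (hs 0)
    simp only [zero_add, hΘ0, Real.cos_zero, mul_one] at h1
    have h2 : Real.cos (Θ s) = 1 := by
      have : r * Real.cos (Θ s) = r * 1 := by rw [h1, mul_one]
      exact mul_left_cancel₀ hr0.ne' this
    obtain ⟨n, hn⟩ := (Real.cos_eq_one_iff _).1 h2
    have h3 : 0 < Θ s := by rw [← hΘ0]; exact hmono hs0
    have h4 : (0 : ℝ) < n := by
      rw [← hn] at h3
      exact (pos_iff_pos_of_mul_pos h3).2 Real.two_pi_pos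
    have h5 : (1 : ℝ) ≤ n := by exact_mod_cast (Int.cast_pos.1 h4 : 0 < n)
    rw [← hr1 s]
    refine (h.strictMono_transitTime hr hrδ).monotone ?_
    rw [← hn]
    nlinarith [Real.pi_pos]

/-- Shifting the angle by `π` changes the sign of the sine and preserves the integral over a full
turn. This isolates the even part of `φ'`. -/
theorem two_mul_transitTime_two_pi (h : EnergyChart g φ δ) (hr : 0 ≤ r) (hrδ : r < δ) :
    2 * transitTime φ r (2 * Real.pi) = ∫ τ in (0 : ℝ)..2 * Real.pi,
      (deriv φ (r * Real.sin τ) + deriv φ (-(r * Real.sin τ))) := by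
  have hc := h.continuous_deriv_mul_sin hr hrδ
  have hp : Function.Periodic (fun τ => deriv φ (r * Real.sin τ)) (2 * Real.pi) := fun τ => by
    simp
  have hneg : (fun τ => deriv φ (-(r * Real.sin τ))) =
      fun τ => deriv φ (r * Real.sin (τ + Real.pi)) := by
    funext τ; rw [Real.sin_add_pi, mul_neg]
  have hc' : Continuous fun τ => deriv φ (-(r * Real.sin τ)) := by
    rw [hneg]; exact hc.comp (continuous_id.add continuous_const)
  have hint : ∫ τ in (0 : ℝ)..2 * Real.pi, deriv φ (-(r * Real.sin τ)) =
      transitTime φ r (2 * Real.pi) := by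
    rw [hneg, intervalIntegral.integral_comp_add_right (fun τ => deriv φ (r * Real.sin τ)),
      add_comm (2 * Real.pi)]
    simpa [transitTime] using hp.intervalIntegral_add_eq (0 + Real.pi) 0
  rw [intervalIntegral.integral_add (hc.intervalIntegrable _ _) (hc'.intervalIntegrable _ _), hint,
    two_mul]
  rfl

end EnergyChart

/-! ### Isochrony as a symmetry of the chart -/

/-- If the averages over circles of an even analytic function vanish, so does the function. -/
theorem eventually_eq_zero_of_integral_comp_mul_sin {d : ℝ → ℝ} {C : ℝ} (hd : AnalyticAt ℝ d 0)
    (hd0 : d 0 = 0) (heven : ∀ s, d (-s) = d s)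
    (hint : ∀ᶠ r in 𝓝[>] 0, ∫ τ in (0 : ℝ)..2 * Real.pi, d (r * Real.sin τ) = C) :
    ∀ᶠ s in 𝓝 0, d s = 0 := by
  have hpi := Real.two_pi_pos
  have hsin : ∀ {r ε : ℝ}, 0 < r → r < ε → ∀ τ, r * Real.sin τ ∈ Ioo (-ε) ε :=
    fun h1 h2 => mul_sin_mem_Ioo h1.le h2
  -- Let `r → 0`: the integrand tends uniformly to `d 0 = 0`.
  have hC : C = 0 := by
    refine abs_eq_zero.1 (le_antisymm (le_of_forall_pos_le_add fun η hη => ?_) (abs_nonneg C))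
    have h1 : ∀ᶠ s in 𝓝 (0 : ℝ), |d s| < η / (2 * Real.pi) := by
      have : ContinuousAt (fun s => |d s|) 0 := hd.continuousAt.abs
      exact this.eventually (gt_mem_nhds (by simp only [hd0, abs_zero]; positivity))
    obtain ⟨ε, hε, hb⟩ := Metric.eventually_nhds_iff_ball.1 h1
    obtain ⟨r, hr, hr1⟩ := (hint.and (Ioo_mem_nhdsGT hε)).exists
    have h2 := intervalIntegral.norm_integral_le_of_norm_le_const (a := 0) (b := 2 * Real.pi)
      (f := fun τ => d (r * Real.sin τ)) (C := η / (2 * Real.pi)) fun τ _ => by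
        refine (hb _ ?_).le
        rw [Real.ball_eq_Ioo, zero_sub, zero_add]
        exact hsin hr1.1 hr1.2 τ
    rw [hr, sub_zero, abs_of_pos hpi, div_mul_cancel₀ _ hpi.ne', Real.norm_eq_abs] at h2
    linarith
  rcases hd.eventually_eq_zero_or_eventually_ne_zero with h | h
  · exact h
  exfalso
  rw [eventually_nhdsWithin_iff] at h
  obtain ⟨ε, hε, hb⟩ := Metric.eventually_nhds_iff_ball.1 (h.and hd.eventually_analyticAt)
  rw [Real.ball_eq_Ioo, zero_sub, zero_add] at hb
  obtain ⟨r, hr, hr1⟩ := (hint.and (Ioo_mem_nhdsGT hε)).exists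
  have hcont : ContinuousOn d (Ioo (-ε) ε) := fun s hs =>
    (hb s hs).2.continuousAt.continuousWithinAt
  have hci : Continuous fun τ => d (r * Real.sin τ) :=
    hcont.comp_continuous (by fun_prop) (hsin hr1.1 hr1.2)
  have hrm : r ∈ Ioo 0 ε := hr1
  have hne : d r ≠ 0 := (hb r ⟨by linarith [hrm.1], hrm.2⟩).1 hrm.1.ne'
  -- If `d` is not identically zero near `0`, it has no zeros on `(0, ε)` and keeps one sign there;
  -- evenness carries the sign to `(-ε, 0)`. The integral then cannot vanish.
  have hsame : ∀ s ∈ Ioo (-ε) ε, 0 ≤ d r * d s := by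
    have hpos : ∀ s ∈ Ioo 0 ε, 0 ≤ d r * d s := by
      intro s hs
      by_contra! hneg
      have h0 : (0 : ℝ) ∈ Icc (d r * d s) (d r * d r) := ⟨hneg.le, mul_self_nonneg _⟩
      obtain ⟨w, hw, hw0⟩ := (isPreconnected_Ioo (a := (0 : ℝ)) (b := ε)).intermediate_value hs hrm
        (f := fun s => d r * d s)
        (continuousOn_const.mul (hcont.mono (Ioo_subset_Ioo_left (by linarith)))) h0
      exact (hb w ⟨by linarith [hw.1], hw.2⟩).1 hw.1.ne'
        ((mul_eq_zero.1 hw0).resolve_left hne)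
    intro s hs
    rcases lt_trichotomy s 0 with h1 | h1 | h1
    · rw [← heven s]
      exact hpos _ ⟨by linarith, by linarith [hs.1]⟩
    · rw [h1, hd0, mul_zero]
    · exact hpos s ⟨h1, hs.2⟩
  have hlt : 0 < ∫ τ in (0 : ℝ)..2 * Real.pi, d r * d (r * Real.sin τ) := by
    refine intervalIntegral.integral_pos hpi (continuous_const.mul hci).continuousOn
      (fun τ _ => hsame _ (hsin hr1.1 hr1.2 τ))
      ⟨Real.pi / 2, ⟨by positivity, by linarith⟩, ?_⟩
    rw [Real.sin_pi_div_two, mul_one]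
    exact mul_self_pos.2 hne
  rw [intervalIntegral.integral_const_mul, hr, hC, mul_zero] at hlt
  exact lt_irrefl _ hlt

namespace EnergyChart

variable {g φ : ℝ → ℝ} {δ r : ℝ}

theorem zero_mem (h : EnergyChart g φ δ) : (0 : ℝ) ∈ Ioo (-δ) δ :=
  ⟨by linarith [h.pos], h.pos⟩

/-- The second identity is the derivative of the first, whose two sides agree at `s = 0`. -/
theorem eventually_deriv_add_deriv_neg (h : EnergyChart g φ δ) :
    (∀ᶠ s in 𝓝 0, φ s - φ (-s) = 2 * s) ↔ ∀ᶠ s in 𝓝 0, deriv φ s + deriv φ (-s) = 2 := by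
  have hmem : ∀ s ∈ Ioo (-δ) δ, -s ∈ Ioo (-δ) δ := fun s hs =>
    ⟨by linarith [hs.2], by linarith [hs.1]⟩
  have hd : ∀ s ∈ Ioo (-δ) δ,
      HasDerivAt (fun s => φ s - φ (-s) - 2 * s) (deriv φ s + deriv φ (-s) - 2) s := by
    intro s hs
    have h1 := (h.analytic s hs).differentiableAt.hasDerivAt
    have h2 := (h.analytic _ (hmem s hs)).differentiableAt.hasDerivAt.comp s (hasDerivAt_neg s)
    have h3 := (h1.sub h2).sub ((hasDerivAt_id s).const_mul 2)
    refine h3.congr_deriv ?_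
    ring
  have hnhds : Ioo (-δ) δ ∈ 𝓝 (0 : ℝ) := Ioo_mem_nhds h.zero_mem.1 h.zero_mem.2
  constructor
  · intro hev
    filter_upwards [hev.eventually_nhds, hnhds] with s hs hsδ
    have : (fun s => φ s - φ (-s) - 2 * s) =ᶠ[𝓝 s] fun _ => 0 :=
      hs.mono fun x hx => sub_eq_zero.2 hx
    have h1 := (hd s hsδ).unique ((hasDerivAt_const s (0 : ℝ)).congr_of_eventuallyEq this)
    linarith
  · intro hev
    obtain ⟨ε, hε, hb⟩ := Metric.eventually_nhds_iff_ball.1 (hev.and hnhds)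
    filter_upwards [Metric.ball_mem_nhds (0 : ℝ) hε] with s hs
    have hd' : ∀ x ∈ Metric.ball (0 : ℝ) ε, HasDerivAt (fun s => φ s - φ (-s) - 2 * s) 0 x :=
      fun x hx => by
        have := hd x (hb x hx).2
        rwa [(hb x hx).1, sub_self] at this
    have h1 := Metric.isOpen_ball.is_const_of_deriv_eq_zero (convex_ball (0 : ℝ) ε).isPreconnected
      (fun x hx => (hd' x hx).differentiableAt.differentiableWithinAt)
      (fun x hx => (hd' x hx).deriv) hs (Metric.mem_ball_self hε)
    simp at h1
    linarith

/-- The center is isochronous if and only if the odd part of the chart is the identity. -/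
theorem isochronousCenter_iff (h : EnergyChart g φ δ) :
    IsochronousCenter g ↔ ∀ᶠ s in 𝓝 0, φ s - φ (-s) = 2 * s := by
  rw [h.eventually_deriv_add_deriv_neg]
  constructor
  · rintro ⟨T, hT⟩
    -- The point `(0, r)` lies on the orbit of amplitude `r` at angle `0`, so testing these points
    -- captures the period for every small amplitude.
    have hpath : Tendsto (fun r : ℝ => ((0 : ℝ), r)) (𝓝[>] 0) (𝓝[≠] 0) := by
      refine tendsto_nhdsWithin_iff.2 ⟨?_, ?_⟩
      · have : Continuous fun r : ℝ => ((0 : ℝ), r) := by fun_prop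
        exact (this.tendsto 0).mono_left nhdsWithin_le_nhds
      · filter_upwards [self_mem_nhdsWithin] with r hr
        intro h0
        exact (ne_of_gt (mem_Ioi.1 hr)) (congrArg Prod.snd h0)
    have htr : ∀ᶠ r in 𝓝[>] (0 : ℝ), transitTime φ r (2 * Real.pi) = T := by
      filter_upwards [hpath.eventually hT, Ioo_mem_nhdsGT h.pos] with r hr hrδ
      obtain ⟨γ, hγ, hγ0, hγT⟩ := hr
      obtain ⟨γ', hγ', hg', hγ'0, hγ'T⟩ := h.exists_orbit hrδ.1.le hrδ.2
      have h0 := hγ'0 0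
      rw [transitTime, intervalIntegral.integral_same, Real.sin_zero, Real.cos_zero, mul_zero,
        mul_one, h.zero, ← hγ0] at h0
      have he := hγ'.eq_of_apply_zero_eq hγ hg' h0
      rw [← he] at hγT
      exact (hγ'T hrδ.1).unique hγT
    have ha : AnalyticAt ℝ (deriv φ) 0 := (h.analytic 0 h.zero_mem).deriv
    have hda : AnalyticAt ℝ (fun s => deriv φ s + deriv φ (-s) - 2) 0 := by
      have h1 : AnalyticAt ℝ (fun s => deriv φ (-s)) 0 :=
        AnalyticAt.fun_comp (f := fun s : ℝ => -s) (by simpa using ha) analyticAt_id.neg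
      exact (ha.add h1).sub analyticAt_const
    have := eventually_eq_zero_of_integral_comp_mul_sin (C := 2 * T - 2 * (2 * Real.pi)) hda
      (by simp [h.deriv_zero]; norm_num) (fun s => by rw [neg_neg, add_comm (deriv φ s)]) ?_
    · exact this.mono fun s hs => sub_eq_zero.1 hs
    filter_upwards [htr, Ioo_mem_nhdsGT h.pos] with r hr hrδ
    have hc := h.continuous_deriv_mul_sin hrδ.1.le hrδ.2
    have hc' : Continuous fun τ => deriv φ (-(r * Real.sin τ)) := by
      have := hc.comp (continuous_id.add (continuous_const (y := Real.pi)))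
      simpa [Function.comp_def, Real.sin_add_pi] using this
    rw [intervalIntegral.integral_sub ((hc.fun_add hc').intervalIntegrable _ _)
      (continuous_const.intervalIntegrable _ _),
      ← h.two_mul_transitTime_two_pi hrδ.1.le hrδ.2, hr]
    simp
    ring
  · intro hev
    obtain ⟨ε, hε, hb⟩ := Metric.eventually_nhds_iff_ball.1
      (hev.and (Ioo_mem_nhds h.zero_mem.1 h.zero_mem.2))
    rw [Real.ball_eq_Ioo, zero_sub, zero_add] at hb
    have hεδ : ∀ r, 0 ≤ r → r < ε → r < δ := fun r h0 h1 => (hb r ⟨by linarith, h1⟩).2.2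
    have hper : ∀ r, 0 ≤ r → r < ε → transitTime φ r (2 * Real.pi) = 2 * Real.pi := by
      intro r h0 h1
      have h2 := h.two_mul_transitTime_two_pi h0 (hεδ r h0 h1)
      rw [intervalIntegral.integral_congr (g := fun _ => (2 : ℝ))
        fun τ _ => (hb _ (mul_sin_mem_Ioo h0 h1 τ)).1] at h2
      simp at h2
      linarith
    have hstrict := (h.analytic 0 h.zero_mem).hasStrictDerivAt
    have hmap := hstrict.map_nhds_eq (by rw [h.deriv_zero]; exact one_ne_zero)
    rw [h.zero] at hmap
    have hx : ∀ᶠ x in 𝓝 (0 : ℝ), ∃ s, |s| < ε / 2 ∧ φ s = x := by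
      rw [← hmap, eventually_map]
      filter_upwards [Metric.ball_mem_nhds (0 : ℝ) (half_pos hε)] with s hs
      exact ⟨s, by simpa [Real.dist_eq] using hs, rfl⟩
    have hy : ∀ᶠ y in 𝓝 (0 : ℝ), |y| < ε / 2 := by
      filter_upwards [Metric.ball_mem_nhds (0 : ℝ) (half_pos hε)] with s hs
      simpa [Real.dist_eq] using hs
    have hxy : ∀ᶠ p in 𝓝 (0 : ℝ × ℝ), (∃ s, |s| < ε / 2 ∧ φ s = p.1) ∧ |p.2| < ε / 2 := by
      rw [← Prod.mk_zero_zero, nhds_prod_eq]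
      exact hx.prod_mk hy
    refine ⟨2 * Real.pi, ?_⟩
    filter_upwards [nhdsWithin_le_nhds hxy, self_mem_nhdsWithin] with p hp hp0
    obtain ⟨⟨s, hs, hsp⟩, hp2⟩ := hp
    -- Polar coordinates in the plane of `(y, s)`: the point `p` has amplitude `‖z‖` and angle `arg
    -- z`.
    set z : ℂ := ⟨p.2, s⟩ with hz
    have hzε : ‖z‖ < ε := (Complex.norm_le_abs_re_add_abs_im z).trans_lt (by
      simp only [hz]; linarith)
    have hz0 : 0 < ‖z‖ := by
      rw [norm_pos_iff]
      intro h0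
      have h1 : p.2 = 0 := congrArg Complex.re h0
      have h2 : s = 0 := congrArg Complex.im h0
      rw [h2, h.zero] at hsp
      exact hp0 (Prod.ext hsp.symm h1)
    obtain ⟨γ, hγ, -, hγ0, hγT⟩ := h.exists_orbit hz0.le (hεδ _ hz0.le hzε)
    rw [hper _ hz0.le hzε] at hγT
    refine ⟨_, hγ.comp_add_const (transitTime φ ‖z‖ z.arg), ?_, (hγT hz0).comp_add_const _⟩
    rw [zero_add, hγ0, Complex.norm_mul_sin_arg, Complex.norm_mul_cos_arg]
    exact Prod.ext hsp rfl

end EnergyChart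

/-! ### The equation for the involution in the chart coordinate -/

/-- A continuous choice of preimages under an analytic function without critical points, on a set
where that function is injective, is analytic. -/
theorem analyticAt_of_rightInverse {G u : ℝ → ℝ} {x : ℝ} {U : Set ℝ} (hG : AnalyticAt ℝ G x)
    (hG' : deriv G x ≠ 0) (hU : U ∈ 𝓝 x) (hinj : InjOn G U)
    (hu : ∀ᶠ E in 𝓝 (G x), u E ∈ U ∧ G (u E) = E) : AnalyticAt ℝ u (G x) := by
  have ha := hG.analyticAt_localInverse hG'
  have hr := hG.hasStrictDerivAt.eventually_right_inverse hG'
  have h0 : hG.hasStrictDerivAt.localInverse _ _ _ hG' (G x) = x :=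
    HasStrictFDerivAt.localInverse_apply_image ..
  refine ha.congr ?_
  have hm := ha.continuousAt.tendsto
  rw [h0] at hm
  filter_upwards [hu, hr, hm.eventually hU] with E h1 h2 h3
  exact hinj h3 h1.1 (h2.trans h1.2.symm)

namespace EnergyChart

variable {g φ : ℝ → ℝ} {δ : ℝ}

/-- In the coordinate `s`, the right-hand side `F` of the equation for the involution. -/
noncomputable def legendre (φ : ℝ → ℝ) (s : ℝ) : ℝ := s * deriv φ s - φ s

theorem analyticAt_legendre (h : EnergyChart g φ δ) : AnalyticAt ℝ (legendre φ) 0 :=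
  (analyticAt_id.mul (h.analytic 0 h.zero_mem).deriv).sub (h.analytic 0 h.zero_mem)

/-- With `w(s) = φ(s) - φ(-s) - 2s`, twice the odd part of `legendre φ` is `s w' - w`. Writing `w =
s v` turns this into `s² v'`. Its vanishing makes `v` constant, equal to `w'(0) = 0`. -/
theorem legendre_even_iff (h : EnergyChart g φ δ) :
    (∀ᶠ s in 𝓝 0, legendre φ (-s) = legendre φ s) ↔ ∀ᶠ s in 𝓝 0, φ s - φ (-s) = 2 * s := by
  constructor
  · intro hev
    have hφ := h.analytic 0 h.zero_mem
    have hφneg : AnalyticAt ℝ (fun s => φ (-s)) 0 :=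
      AnalyticAt.fun_comp (f := fun s : ℝ => -s) (by simpa using hφ) analyticAt_id.neg
    set w : ℝ → ℝ := fun s => φ s - φ (-s) - 2 * s with hw
    have hwa : AnalyticAt ℝ w 0 := (hφ.sub hφneg).sub (analyticAt_const.mul analyticAt_id)
    have hwd : ∀ s ∈ Ioo (-δ) δ, HasDerivAt w (deriv φ s + deriv φ (-s) - 2) s := by
      intro s hs
      have h1 := (h.analytic s hs).differentiableAt.hasDerivAt
      have h2 := (h.analytic (-s) ⟨by linarith [hs.2], by linarith [hs.1]⟩).differentiableAt
        |>.hasDerivAt.comp s (hasDerivAt_neg s)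
      refine ((h1.sub h2).sub ((hasDerivAt_id s).const_mul 2)).congr_deriv ?_
      ring
    have hw0 : w 0 = 0 := by simp [hw]
    have hwd0 : deriv w 0 = 0 := by
      rw [(hwd 0 h.zero_mem).deriv, neg_zero, h.deriv_zero]; norm_num
    obtain ⟨p, hp⟩ := hwa
    have hva : AnalyticAt ℝ (dslope w 0) 0 := ⟨_, hp.has_fpower_series_dslope_fslope⟩
    have hwv : ∀ s, w s = s * dslope w 0 s := fun s => by
      have := sub_smul_dslope w 0 s
      rw [hw0, sub_zero, sub_zero, smul_eq_mul] at this
      exact this.symm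
    have hv' : ∀ᶠ s in 𝓝[≠] 0, deriv (dslope w 0) s = 0 := by
      filter_upwards [nhdsWithin_le_nhds hev, nhdsWithin_le_nhds hva.eventually_analyticAt,
        nhdsWithin_le_nhds (Ioo_mem_nhds h.zero_mem.1 h.zero_mem.2), self_mem_nhdsWithin]
        with s h1 h2 h3 h4
      have h5 := (hasDerivAt_id s).mul h2.differentiableAt.hasDerivAt
      have h6 := (hwd s h3).unique (h5.congr_of_eventuallyEq (Eventually.of_forall hwv))
      simp only [id, one_mul] at h6
      simp only [legendre] at h1
      have h7 : φ s - φ (-s) - 2 * s = s * dslope w 0 s := hwv s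
      have h8 : s * s * deriv (dslope w 0) s = 0 := by
        linear_combination (-s) * h6 + h7 - h1
      exact (mul_eq_zero.1 h8).resolve_left (mul_self_ne_zero.2 h4)
    have hv'' : ∀ᶠ s in 𝓝 0, deriv (dslope w 0) s = 0 :=
      hva.deriv.frequently_zero_iff_eventually_zero.1 hv'.frequently
    obtain ⟨ε, hε, hb⟩ := Metric.eventually_nhds_iff_ball.1 (hv''.and hva.eventually_analyticAt)
    filter_upwards [Metric.ball_mem_nhds (0 : ℝ) hε] with s hs
    have h1 := Metric.isOpen_ball.is_const_of_deriv_eq_zero (convex_ball (0 : ℝ) ε).isPreconnected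
      (fun x hx => (hb x hx).2.differentiableAt.differentiableWithinAt)
      (fun x hx => (hb x hx).1) hs (Metric.mem_ball_self hε)
    have h2 := hwv s
    rw [h1, dslope_same, hwd0, mul_zero] at h2
    exact sub_eq_zero.1 h2
  · intro hev
    filter_upwards [hev, h.eventually_deriv_add_deriv_neg.1 hev] with s h1 h2
    simp only [legendre]
    linear_combination h1 - s * h2

theorem hasDerivAt_comp_mul_sqrt (h : EnergyChart g φ δ) {u : ℝ → ℝ} {σ E : ℝ} (hE : 0 < E)
    (hmem : σ * √(2 * E) ∈ Ioo (-δ) δ) (hu : ∀ᶠ e in 𝓝 E, u e = φ (σ * √(2 * e))) :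
    HasDerivAt u (deriv φ (σ * √(2 * E)) * (σ / √(2 * E))) E := by
  have h1 : HasDerivAt (fun e => σ * √(2 * e)) (σ / √(2 * E)) E := by
    have := (((hasDerivAt_id E).const_mul 2).sqrt (by simp [hE.ne'])).const_mul σ
    refine this.congr_deriv ?_
    have : √(2 * E) ≠ 0 := (Real.sqrt_pos.2 (by positivity)).ne'
    simp only [id]
    field_simp
  exact ((h.analytic _ hmem).differentiableAt.hasDerivAt.comp E h1).congr_of_eventuallyEq hu

/-- For `s = σ√(2E)` the operator `2E d/dE` is `s d/ds`. -/
theorem two_mul_deriv_sub (h : EnergyChart g φ δ) {u : ℝ → ℝ} {σ E : ℝ} (hE : 0 < E)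
    (hmem : σ * √(2 * E) ∈ Ioo (-δ) δ) (hu : ∀ᶠ e in 𝓝 E, u e = φ (σ * √(2 * e))) :
    2 * E * deriv u E - u E = legendre φ (σ * √(2 * E)) := by
  rw [(h.hasDerivAt_comp_mul_sqrt hE hmem hu).deriv, hu.self_of_nhds, legendre]
  have h1 : √(2 * E) ≠ 0 := (Real.sqrt_pos.2 (by positivity)).ne'
  have h2 : √(2 * E) ^ 2 = 2 * E := Real.sq_sqrt (by positivity)
  rw [← h2]
  simp only [Real.sqrt_sq (Real.sqrt_nonneg _)]
  field_simp

end EnergyChart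

theorem tendsto_mul_sqrt {σ : ℝ} (hσ : σ ≠ 0) :
    Tendsto (fun E => σ * √(2 * E)) (𝓝[>] 0) (𝓝[≠] 0) := by
  refine tendsto_nhdsWithin_iff.2 ⟨?_, ?_⟩
  · have : Continuous fun E : ℝ => σ * √(2 * E) := by fun_prop
    simpa using (this.tendsto 0).mono_left nhdsWithin_le_nhds
  · filter_upwards [self_mem_nhdsWithin] with E hE
    have hE : 0 < E := hE
    exact mul_ne_zero hσ (Real.sqrt_pos.2 (by positivity)).ne'

/-! ### The two branches of the involution on the well -/

section Well

variable {g : ℝ → ℝ} {a b c : ℝ}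

theorem PotentialWell.energy_pos (h : PotentialWell g a b c) : 0 < c := by
  simpa [potential_zero] using h.lt 0 ⟨h.neg, h.pos⟩

theorem analyticAt_potential (hg : AnalyticOnNhd ℝ g (Icc a b)) (h : PotentialWell g a b c) {x : ℝ}
    (hx : x ∈ Ioo a b) : AnalyticAt ℝ (potential g) x := by
  refine analyticAt_of_hasDerivAt (hg x (Ioo_subset_Icc_self hx)) ?_
  filter_upwards [Ioo_mem_nhds hx.1 hx.2] with y hy
  exact hasDerivAt_potential h.neg h.pos hg (Ioo_subset_Icc_self hy)

theorem involution_eq (hg : AnalyticOnNhd ℝ g (Icc a b)) (h : PotentialWell g a b c) {x z : ℝ}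
    (hx : x ∈ Icc a b) (hz : z ∈ Icc a b) (hzx : potential g z = potential g x)
    (hneg : z * x < 0) : involution g a b x = z :=
  have hx0 : x ≠ 0 := fun h0 => by simp [h0] at hneg
  (existsUnique_involution hg h hx hx0).unique (involution_spec hg h hx hx0) ⟨hz, hzx, hneg⟩

theorem involutionOfPotential_potential {s : Set ℝ} {x : ℝ} (hs : InjOn (potential g) s)
    (hx : x ∈ s) : involutionOfPotential g a b s (potential g x) = involution g a b x := by
  rw [involutionOfPotential, hs.leftInvOn_invFunOn hx]

theorem involutionOfPotential_left (hg : AnalyticOnNhd ℝ g (Icc a b)) (h : PotentialWell g a b c)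
    {x z : ℝ} (hx : x ∈ Ico a 0) (hz : z ∈ Ioc 0 b) (hzx : potential g z = potential g x) :
    involutionOfPotential g a b (Icc a 0) (potential g z) = z := by
  rw [hzx, involutionOfPotential_potential (strictAntiOn_potential hg h).injOn
    (Ico_subset_Icc_self hx)]
  exact involution_eq hg h ⟨hx.1, hx.2.le.trans h.pos.le⟩ ⟨h.neg.le.trans hz.1.le, hz.2⟩ hzx
    (mul_neg_of_pos_of_neg hz.1 hx.2)

theorem involutionOfPotential_right (hg : AnalyticOnNhd ℝ g (Icc a b)) (h : PotentialWell g a b c)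
    {x z : ℝ} (hx : x ∈ Ioc 0 b) (hz : z ∈ Ico a 0) (hzx : potential g z = potential g x) :
    involutionOfPotential g a b (Icc 0 b) (potential g z) = z := by
  rw [hzx, involutionOfPotential_potential (strictMonoOn_potential hg h).injOn
    (Ioc_subset_Icc_self hx)]
  exact involution_eq hg h ⟨h.neg.le.trans hx.1.le, hx.2⟩ ⟨hz.1, hz.2.le.trans h.pos.le⟩ hzx
    (mul_neg_of_neg_of_pos hz.2 hx.1)

theorem involutionOfPotential_spec (hg : AnalyticOnNhd ℝ g (Icc a b)) (h : PotentialWell g a b c)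
    {E : ℝ} (hE : E ∈ Ioo 0 c) :
    (involutionOfPotential g a b (Icc a 0) E ∈ Ioo 0 b ∧
      potential g (involutionOfPotential g a b (Icc a 0) E) = E) ∧
    (involutionOfPotential g a b (Icc 0 b) E ∈ Ioo a 0 ∧
      potential g (involutionOfPotential g a b (Icc 0 b) E) = E) := by
  have hc : ContinuousOn (potential g) (Icc a b) := fun y hy =>
    (hasDerivAt_potential h.neg h.pos hg hy).continuousAt.continuousWithinAt
  obtain ⟨x, hx, hxE⟩ := intermediate_value_Ioo' h.neg.le
    (hc.mono (Icc_subset_Icc_right h.pos.le)) (by rwa [h.left, potential_zero])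
  obtain ⟨z, hz, hzE⟩ := intermediate_value_Ioo h.pos.le
    (hc.mono (Icc_subset_Icc_left h.neg.le)) (by rwa [h.right, potential_zero])
  have h1 := involutionOfPotential_left hg h (Ioo_subset_Ico_self hx) (Ioo_subset_Ioc_self hz)
    (hzE.trans hxE.symm)
  have h2 := involutionOfPotential_right hg h (Ioo_subset_Ioc_self hz) (Ioo_subset_Ico_self hx)
    (hxE.trans hzE.symm)
  rw [hzE] at h1
  rw [hxE] at h2
  rw [h1, h2]
  exact ⟨⟨hz, hzE⟩, hx, hxE⟩

theorem deriv_potential_ne_zero (hg : AnalyticOnNhd ℝ g (Icc a b)) (h : PotentialWell g a b c)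
    {x : ℝ} (hx : x ∈ Ioo a b) (hx0 : x ≠ 0) : deriv (potential g) x ≠ 0 := by
  rw [(hasDerivAt_potential h.neg h.pos hg (Ioo_subset_Icc_self hx)).deriv]
  intro h0
  have := h.sign x hx hx0
  rw [h0, mul_zero] at this
  exact lt_irrefl _ this

theorem analyticAt_involutionOfPotential (hg : AnalyticOnNhd ℝ g (Icc a b))
    (h : PotentialWell g a b c) {E : ℝ} (hE : E ∈ Ioo 0 c) :
    AnalyticAt ℝ (involutionOfPotential g a b (Icc a 0)) E ∧
      AnalyticAt ℝ (involutionOfPotential g a b (Icc 0 b)) E := by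
  have hnhds : Ioo 0 c ∈ 𝓝 E := Ioo_mem_nhds hE.1 hE.2
  obtain ⟨⟨h1, h2⟩, h3, h4⟩ := involutionOfPotential_spec hg h hE
  constructor
  · have hm : involutionOfPotential g a b (Icc a 0) E ∈ Ioo a b := ⟨h.neg.trans h1.1, h1.2⟩
    have := analyticAt_of_rightInverse (u := involutionOfPotential g a b (Icc a 0))
      (analyticAt_potential hg h hm) (deriv_potential_ne_zero hg h hm h1.1.ne')
      (Ioo_mem_nhds h1.1 h1.2) ((strictMonoOn_potential hg h).injOn.mono Ioo_subset_Icc_self)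
      (by rw [h2]; filter_upwards [hnhds] with e he using (involutionOfPotential_spec hg h he).1)
    rwa [h2] at this
  · have hm : involutionOfPotential g a b (Icc 0 b) E ∈ Ioo a b := ⟨h3.1, h3.2.trans h.pos⟩
    have := analyticAt_of_rightInverse (u := involutionOfPotential g a b (Icc 0 b))
      (analyticAt_potential hg h hm) (deriv_potential_ne_zero hg h hm h3.2.ne)
      (Ioo_mem_nhds h3.1 h3.2) ((strictAntiOn_potential hg h).injOn.mono Ioo_subset_Icc_self)
      (by rw [h4]; filter_upwards [hnhds] with e he using (involutionOfPotential_spec hg h he).2)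
    rwa [h4] at this

/-- The points `φ(r)` and `φ(-r)` have the same energy `r²/2` and opposite signs, so the involution
exchanges them. -/
theorem exists_energyChart (hg : AnalyticOnNhd ℝ g (Icc a b)) (h : PotentialWell g a b c)
    (hg0 : g 0 = 0) (hg1 : deriv g 0 = 1) :
    ∃ φ δ, EnergyChart g φ δ ∧ ∀ r ∈ Ioo 0 δ,
      involutionOfPotential g a b (Icc a 0) (r ^ 2 / 2) = φ r ∧
        involutionOfPotential g a b (Icc 0 b) (r ^ 2 / 2) = φ (-r) := by
  have h0 : (0 : ℝ) ∈ Ioo a b := ⟨h.neg, h.pos⟩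
  have hGd := fun x hx => hasDerivAt_potential (x := x) h.neg h.pos hg hx
  obtain ⟨φ, hφ, hφ0, hφ1, hGφ⟩ := exists_analytic_morse_chart (hg 0 (Ioo_subset_Icc_self h0)) hg0 hg1
    (by filter_upwards [Ioo_mem_nhds h.neg h.pos] with x hx using hGd x (Ioo_subset_Icc_self hx))
    (potential_zero g)
  have hφm : ∀ᶠ s in 𝓝 0, φ s ∈ Ioo a b :=
    hφ.continuousAt.eventually (by rw [hφ0]; exact Ioo_mem_nhds h.neg h.pos)
  have hφp : ∀ᶠ s in 𝓝 0, 0 < deriv φ s :=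
    hφ.deriv.continuousAt.eventually (lt_mem_nhds (by rw [hφ1]; exact one_pos))
  obtain ⟨δ, hδ, hb⟩ := Metric.eventually_nhds_iff_ball.1
    (hφ.eventually_analyticAt.and (hφm.and (hφp.and hGφ.eventually_nhds)))
  rw [Real.ball_eq_Ioo, zero_sub, zero_add] at hb
  have hmono : StrictMonoOn φ (Ioo (-δ) δ) := by
    refine strictMonoOn_of_deriv_pos (convex_Ioo _ _)
      (fun s hs => (hb s hs).1.continuousAt.continuousWithinAt) fun s hs => ?_
    rw [interior_Ioo] at hs
    exact (hb s hs).2.2.1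
  have hz : (0 : ℝ) ∈ Ioo (-δ) δ := ⟨by linarith, hδ⟩
  refine ⟨φ, δ, ⟨hδ, hφ0, hφ1, fun s hs => (hb s hs).1, fun s hs => (hb s hs).2.2.1,
    fun s hs => hg _ (Ioo_subset_Icc_self (hb s hs).2.1), fun s hs => ?_⟩, fun r hr => ?_⟩
  · have h1 := (hGd (φ s) (Ioo_subset_Icc_self (hb s hs).2.1)).comp s
      (hb s hs).1.differentiableAt.hasDerivAt
    have h2 := ((hasDerivAt_pow 2 s).div_const 2).congr_of_eventuallyEq (hb s hs).2.2.2
    rw [h1.unique h2]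
    simp
  · have hr1 : r ∈ Ioo (-δ) δ := ⟨by linarith [hr.1], hr.2⟩
    have hr2 : -r ∈ Ioo (-δ) δ := ⟨by linarith [hr.2], by linarith [hr.1]⟩
    have hpos : 0 < φ r := by rw [← hφ0]; exact hmono hz hr1 hr.1
    have hneg : φ (-r) < 0 := by rw [← hφ0]; exact hmono hr2 hz (by linarith [hr.1])
    have e1 : potential g (φ r) = r ^ 2 / 2 := (hb r hr1).2.2.2.self_of_nhds
    have e2 : potential g (φ (-r)) = r ^ 2 / 2 := by
      rw [(hb _ hr2).2.2.2.self_of_nhds, neg_sq]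
    have m1 : φ r ∈ Ioc 0 b := ⟨hpos, (hb r hr1).2.1.2.le⟩
    have m2 : φ (-r) ∈ Ico a 0 := ⟨(hb _ hr2).2.1.1.le, hneg⟩
    have k1 := involutionOfPotential_left hg h m2 m1 (e1.trans e2.symm)
    have k2 := involutionOfPotential_right hg h m1 m2 (e2.trans e1.symm)
    rw [e1] at k1
    rw [e2] at k2
    exact ⟨k1, k2⟩

end Well

/-! ### From the equation to the symmetry of the chart, and back -/

variable {g φ : ℝ → ℝ} {a b c δ : ℝ}

theorem tendsto_sq_div_two_mul (h : EnergyChart g φ δ) {u : ℝ → ℝ} {σ : ℝ} (hσ : σ ^ 2 = 1)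
    (hu : ∀ᶠ E in 𝓝[>] 0, u E = φ (σ * √(2 * E))) :
    Tendsto (fun E => u E ^ 2 / (2 * E)) (𝓝[>] 0) (𝓝 1) := by
  have hσ0 : σ ≠ 0 := fun h0 => by simp [h0] at hσ
  have h1 := hasDerivAt_iff_tendsto_slope.1 (h.analytic 0 h.zero_mem).differentiableAt.hasDerivAt
  rw [h.deriv_zero] at h1
  have h2 := (h1.comp (tendsto_mul_sqrt hσ0)).pow 2
  rw [one_pow] at h2
  refine h2.congr' ?_
  filter_upwards [hu, self_mem_nhdsWithin] with E h3 hE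
  have hE : 0 < E := hE
  rw [Function.comp_apply, slope_def_field, h.zero, sub_zero, sub_zero, ← h3, div_pow, mul_pow, hσ,
    one_mul, Real.sq_sqrt (by positivity)]

/-- If the equation holds near `0` on a branch, the odd part of the chart is the identity. -/
theorem EnergyChart.odd_part_eq_of_solvesODEAt (h : EnergyChart g φ δ) {f u : ℝ → ℝ} {σ : ℝ}
    (hσ : σ ^ 2 = 1) (hf : AnalyticAt ℝ f 0) (hu : ∀ᶠ E in 𝓝[>] 0, u E = φ (σ * √(2 * E)))
    (hode : ∀ᶠ E in 𝓝[>] 0, SolvesODEAt f u E) : ∀ᶠ s in 𝓝 0, φ s - φ (-s) = 2 * s := by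
  have hσ0 : σ ≠ 0 := fun h0 => by simp [h0] at hσ
  rw [← h.legendre_even_iff]
  set F : ℝ → ℝ := fun E => ∫ τ in (0 : ℝ)..E, f τ with hF
  have hFa : AnalyticAt ℝ F 0 := by
    obtain ⟨ε, hε, hb⟩ := Metric.eventually_nhds_iff_ball.1 hf.eventually_analyticAt
    refine analyticAt_of_hasDerivAt hf ?_
    filter_upwards [Metric.ball_mem_nhds (0 : ℝ) hε] with x hx
    have hcont : ContinuousOn f (Metric.ball 0 ε) := fun y hy =>
      (hb y hy).continuousAt.continuousWithinAt
    have hsub : uIcc 0 x ⊆ Metric.ball 0 ε :=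
      (convex_ball (0 : ℝ) ε).ordConnected.uIcc_subset (Metric.mem_ball_self hε) hx
    exact intervalIntegral.integral_hasDerivAt_right (hcont.mono hsub).intervalIntegrable
      (hcont.stronglyMeasurableAtFilter Metric.isOpen_ball x hx) (hb x hx).continuousAt
  have hFs : AnalyticAt ℝ (fun s => F (s ^ 2 / 2)) 0 :=
    AnalyticAt.fun_comp (f := fun s : ℝ => s ^ 2 / 2) (by simpa using hFa)
      (by fun_prop)
  have hd : AnalyticAt ℝ (fun s => EnergyChart.legendre φ s - F (s ^ 2 / 2)) 0 :=
    h.analyticAt_legendre.sub hFs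
  have hz : ∀ᶠ E in 𝓝[>] (0 : ℝ),
      EnergyChart.legendre φ (σ * √(2 * E)) - F ((σ * √(2 * E)) ^ 2 / 2) = 0 := by
    have hmem := (tendsto_mul_sqrt hσ0).eventually
      (nhdsWithin_le_nhds (Ioo_mem_nhds h.zero_mem.1 h.zero_mem.2))
    filter_upwards [eventually_eventually_nhdsWithin.2 hu, hmem, hode, self_mem_nhdsWithin]
      with E h1 h2 h3 hE
    have hE' : 0 < E := hE
    rw [nhdsWithin_eq_nhds.2 (Ioi_mem_nhds hE')] at h1
    rw [← h.two_mul_deriv_sub hE' h2 h1, h3.2, mul_pow, hσ, one_mul, Real.sq_sqrt (by positivity),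
      mul_div_cancel_left₀ _ two_ne_zero]
    ring
  -- The equation is known only on the side of `0` given by `σ`, but zeros accumulating at `0` force
  -- an analytic function to vanish on both sides. There `legendre φ` equals a function of `s²`.
  have hfr := (tendsto_mul_sqrt hσ0).frequently
    (p := fun s => EnergyChart.legendre φ s - F (s ^ 2 / 2) = 0) hz.frequently
  have hev := hd.frequently_zero_iff_eventually_zero.1 hfr
  have hneg : Tendsto (fun x : ℝ => -x) (𝓝 0) (𝓝 0) := by
    simpa using (continuous_neg (G := ℝ)).tendsto 0
  filter_upwards [hev, hneg.eventually hev] with s h1 h2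
  rw [neg_sq] at h2
  linarith

/-- Gluing at `0`: a function analytic on `(0, c)` that agrees on the right of `0` with a function
analytic at `0` and vanishing there is the integral of a function analytic on `[0, c)`. -/
theorem exists_analyticOnNhd_integral_eq {F F₀ : ℝ → ℝ} (hF : ∀ E ∈ Ioo 0 c, AnalyticAt ℝ F E)
    (hF₀ : AnalyticAt ℝ F₀ 0) (h0 : F₀ 0 = 0) (hev : ∀ᶠ E in 𝓝[>] 0, F E = F₀ E) :
    ∃ f : ℝ → ℝ, AnalyticOnNhd ℝ f (Ico 0 c) ∧ ∀ E ∈ Ioo 0 c, ∫ τ in (0 : ℝ)..E, f τ = F E := by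
  -- Using `F₀` on `E ≤ 0` makes `H` analytic across `0` with `H 0 = 0`; then `f` is its derivative.
  set H : ℝ → ℝ := fun E => if E ≤ 0 then F₀ E else F E with hH
  have hH0 : F₀ =ᶠ[𝓝 0] H := by
    rw [eventually_nhdsWithin_iff] at hev
    filter_upwards [hev] with E hE
    by_cases hE0 : E ≤ 0
    · simp [hH, hE0]
    · simp [hH, hE0, hE (lt_of_not_ge hE0)]
  have hHa : AnalyticOnNhd ℝ H (Ico 0 c) := by
    intro E hE
    rcases hE.1.eq_or_lt with rfl | hpos
    · exact hF₀.congr hH0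
    · refine (hF E ⟨hpos, hE.2⟩).congr ?_
      filter_upwards [Ioi_mem_nhds hpos] with e he
      simp [hH, not_le.2 (mem_Ioi.1 he)]
  refine ⟨deriv H, fun E hE => (hHa E hE).deriv, fun E hE => ?_⟩
  have hsub : uIcc 0 E ⊆ Ico 0 c := by
    rw [uIcc_of_le hE.1.le]
    exact fun x hx => ⟨hx.1, hx.2.trans_lt hE.2⟩
  rw [intervalIntegral.integral_deriv_eq_sub (fun x hx => (hHa x (hsub hx)).differentiableAt)
    (ContinuousOn.intervalIntegrable fun x hx =>
      (hHa x (hsub hx)).deriv.continuousAt.continuousWithinAt)]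
  simp [hH, not_le.2 hE.1, h0]

theorem eventually_involutionOfPotential_eq (h : EnergyChart g φ δ)
    (hφ : ∀ r ∈ Ioo 0 δ, involutionOfPotential g a b (Icc a 0) (r ^ 2 / 2) = φ r ∧
        involutionOfPotential g a b (Icc 0 b) (r ^ 2 / 2) = φ (-r)) :
    ∀ᶠ E in 𝓝[>] (0 : ℝ), involutionOfPotential g a b (Icc a 0) E = φ (1 * √(2 * E)) ∧
      involutionOfPotential g a b (Icc 0 b) E = φ ((-1) * √(2 * E)) := by
  filter_upwards [(tendsto_mul_sqrt one_ne_zero).eventually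
    (nhdsWithin_le_nhds (Iio_mem_nhds h.pos)), self_mem_nhdsWithin] with E h2 hE
  have hE' : 0 < E := hE
  rw [one_mul] at h2
  have h3 := hφ √(2 * E) ⟨Real.sqrt_pos.2 (by positivity), h2⟩
  rw [Real.sq_sqrt (by positivity), mul_div_cancel_left₀ _ two_ne_zero] at h3
  rwa [one_mul, neg_one_mul]

/-- For an isochronous center the two branches of the involution differ by `2√(2E)`. -/
theorem involutionOfPotential_sub_eq (hg : AnalyticOnNhd ℝ g (Icc a b)) (hw : PotentialWell g a b c)
    (h : EnergyChart g φ δ)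
    (hφ : ∀ r ∈ Ioo 0 δ, involutionOfPotential g a b (Icc a 0) (r ^ 2 / 2) = φ r ∧
        involutionOfPotential g a b (Icc 0 b) (r ^ 2 / 2) = φ (-r))
    (hodd : ∀ᶠ s in 𝓝 0, φ s - φ (-s) = 2 * s) :
    ∀ E ∈ Ioo 0 c, involutionOfPotential g a b (Icc a 0) E -
      involutionOfPotential g a b (Icc 0 b) E = 2 * √(2 * E) := by
  have ha := fun E (hE : E ∈ Ioo 0 c) => analyticAt_involutionOfPotential hg hw hE
  have hs : AnalyticOnNhd ℝ (fun E => 2 * √(2 * E)) (Ioo 0 c) := fun E hE =>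
    analyticAt_const.mul (ContDiffAt.analyticAt
      ((contDiffAt_const.mul contDiffAt_id).sqrt (by simp [hE.1.ne'])))
  have hnear : ∀ᶠ E in 𝓝[>] (0 : ℝ), involutionOfPotential g a b (Icc a 0) E -
      involutionOfPotential g a b (Icc 0 b) E = 2 * √(2 * E) := by
    filter_upwards [(tendsto_mul_sqrt one_ne_zero).eventually (nhdsWithin_le_nhds hodd),
      eventually_involutionOfPotential_eq h hφ] with E h1 h2
    rw [one_mul] at h1
    rw [h2.1, h2.2, one_mul, neg_one_mul, h1]
  -- A base point in `(0, c)` with the identity valid on a whole neighbourhood, as the identity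
  -- theorem requires.
  obtain ⟨E₀, hE₀, hE₀c⟩ := ((eventually_eventually_nhdsWithin.2 hnear).and
    (Ioo_mem_nhdsGT hw.energy_pos)).exists
  have hE₀m : E₀ ∈ Ioo 0 c := hE₀c
  rw [nhdsWithin_eq_nhds.2 (Ioi_mem_nhds hE₀m.1)] at hE₀
  exact AnalyticOnNhd.eqOn_of_preconnected_of_eventuallyEq
    (fun E hE => (ha E hE).1.sub (ha E hE).2) hs isPreconnected_Ioo hE₀m hE₀

/-- The function `f` is built from the branch over `[a, 0]`, where evenness of `legendre φ` gives
analyticity at `E = 0`. The other branch differs by `2√(2E)`, a solution of the homogeneous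
equation, so the same `f` works. -/
theorem exists_solvesODEAt (hg : AnalyticOnNhd ℝ g (Icc a b)) (hw : PotentialWell g a b c)
    (h : EnergyChart g φ δ)
    (hφ : ∀ r ∈ Ioo 0 δ, involutionOfPotential g a b (Icc a 0) (r ^ 2 / 2) = φ r ∧
        involutionOfPotential g a b (Icc 0 b) (r ^ 2 / 2) = φ (-r))
    (hodd : ∀ᶠ s in 𝓝 0, φ s - φ (-s) = 2 * s) :
    ∃ f : ℝ → ℝ, AnalyticOnNhd ℝ f (Ico 0 c) ∧ ∀ E ∈ Ioo 0 c,
      SolvesODEAt f (involutionOfPotential g a b (Icc a 0)) E ∧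
        SolvesODEAt f (involutionOfPotential g a b (Icc 0 b)) E := by
  have ha := fun E (hE : E ∈ Ioo 0 c) => analyticAt_involutionOfPotential hg hw hE
  have hsub := involutionOfPotential_sub_eq hg hw h hφ hodd
  have hu := (eventually_involutionOfPotential_eq h hφ).mono fun E hE => hE.1
  set u := involutionOfPotential g a b (Icc a 0) with hu_def
  set v := involutionOfPotential g a b (Icc 0 b) with hv_def
  obtain ⟨K, hK, hKe⟩ := exists_analyticAt_comp_sq h.analyticAt_legendre
    (h.legendre_even_iff.2 hodd)
  have hF₀ : AnalyticAt ℝ (fun E => K (2 * E)) 0 :=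
    AnalyticAt.fun_comp (f := fun E : ℝ => 2 * E) (by simpa using hK) (by fun_prop)
  have hK0 : K (2 * 0) = 0 := by
    have := hKe.self_of_nhds
    simpa [EnergyChart.legendre, h.zero, eq_comm] using this
  obtain ⟨f, hfa, hf⟩ := exists_analyticOnNhd_integral_eq (c := c)
    (F := fun E => 2 * E * deriv u E - u E)
    (fun E hE => ((analyticAt_const.mul analyticAt_id).mul (ha E hE).1.deriv).sub (ha E hE).1)
    hF₀ hK0 (by
      have ht := tendsto_mul_sqrt one_ne_zero
      filter_upwards [eventually_eventually_nhdsWithin.2 hu, ht.eventually (nhdsWithin_le_nhds hKe),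
        ht.eventually (nhdsWithin_le_nhds (Ioo_mem_nhds h.zero_mem.1 h.zero_mem.2)),
        self_mem_nhdsWithin] with E h1 h2 h3 hE
      have hE' : 0 < E := hE
      rw [nhdsWithin_eq_nhds.2 (Ioi_mem_nhds hE')] at h1
      rw [h.two_mul_deriv_sub hE' h3 h1, h2, one_mul, Real.sq_sqrt (by positivity)])
  refine ⟨f, hfa, fun E hE => ⟨⟨(ha E hE).1.differentiableAt, ?_⟩,
    (ha E hE).2.differentiableAt, ?_⟩⟩
  · rw [hf E hE]; ring
  · have hv : v =ᶠ[𝓝 E] fun e => u e - 2 * √(2 * e) := by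
      filter_upwards [Ioo_mem_nhds hE.1 hE.2] with e he
      rw [← hsub e he]; ring
    have hpos : 0 < 2 * E := by linarith [hE.1]
    have h1 : HasDerivAt (fun e => 2 * √(2 * e)) (2 / √(2 * E)) E := by
      have := (((hasDerivAt_id E).const_mul 2).sqrt (by simp [hE.1.ne'])).const_mul 2
      refine this.congr_deriv ?_
      have : √(2 * E) ≠ 0 := (Real.sqrt_pos.2 hpos).ne'
      simp only [id]
      field_simp
    have h2 := ((ha E hE).1.differentiableAt.hasDerivAt.sub h1).congr_of_eventuallyEq hv
    have h3 : √(2 * E) ≠ 0 := (Real.sqrt_pos.2 hpos).ne'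
    have h4 : 2 * E * (2 / √(2 * E)) = 2 * √(2 * E) := by
      field_simp
      rw [Real.sq_sqrt hpos.le]
    rw [hf E hE, h2.deriv, hv.self_of_nhds, mul_sub, h4]
    ring

end Isochrony

/-! ### The theorem -/

theorem mainTheorem10 (g : ℝ → ℝ) (a b c : ℝ)
    (hg : AnalyticOnNhd ℝ g (Icc a b))
    (hwell : PotentialWell g a b c)
    (hg0 : g 0 = 0) (hg1 : deriv g 0 = 1) :
    -- on each of the two branches `s` of the inverse of the potential
    (∀ s ∈ ({Icc a 0, Icc 0 b} : Set (Set ℝ)),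
      (IsochronousCenter g ↔
        ∃ f : ℝ → ℝ, AnalyticAt ℝ f 0 ∧
          ∀ᶠ E in 𝓝[>] (0 : ℝ), SolvesODEAt f (involutionOfPotential g a b s) E) ∧
      involutionOfPotential g a b s 0 = 0 ∧
      Tendsto (fun E => involutionOfPotential g a b s E ^ 2 / (2 * E)) (𝓝[>] 0) (𝓝 1)) ∧
    -- and one `f` serves both branches and all energies below `c`
    (IsochronousCenter g →
      ∃ f : ℝ → ℝ, AnalyticOnNhd ℝ f (Ico 0 c) ∧
        ∀ s ∈ ({Icc a 0, Icc 0 b} : Set (Set ℝ)), ∀ E ∈ Ioo 0 c,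
          SolvesODEAt f (involutionOfPotential g a b s) E) := by
  obtain ⟨φ, δ, h, hφ⟩ := exists_energyChart hg hwell hg0 hg1
  have hbr : ∀ s ∈ ({Icc a 0, Icc 0 b} : Set (Set ℝ)), InjOn (potential g) s ∧ (0 : ℝ) ∈ s ∧
      ∃ σ : ℝ, σ ^ 2 = 1 ∧
        ∀ᶠ E in 𝓝[>] 0, involutionOfPotential g a b s E = φ (σ * √(2 * E)) := by
    have hev := eventually_involutionOfPotential_eq h hφ
    rintro s (rfl | rfl)
    -- On `[a, 0]` the involution takes positive values, hence `σ = 1`; on `[0, b]` it is `σ = -1`.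
    · exact ⟨(strictAntiOn_potential hg hwell).injOn, right_mem_Icc.2 hwell.neg.le, 1, by norm_num,
        hev.mono fun E hE => hE.1⟩
    · exact ⟨(strictMonoOn_potential hg hwell).injOn, left_mem_Icc.2 hwell.pos.le, -1, by norm_num,
        hev.mono fun E hE => hE.2⟩
  have hmain : IsochronousCenter g → ∃ f : ℝ → ℝ, AnalyticOnNhd ℝ f (Ico 0 c) ∧
      ∀ s ∈ ({Icc a 0, Icc 0 b} : Set (Set ℝ)), ∀ E ∈ Ioo 0 c,
        SolvesODEAt f (involutionOfPotential g a b s) E := by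
    intro hiso
    obtain ⟨f, hfa, hf⟩ := exists_solvesODEAt hg hwell h hφ (h.isochronousCenter_iff.1 hiso)
    refine ⟨f, hfa, ?_⟩
    rintro s (rfl | rfl) E hE
    · exact (hf E hE).1
    · exact (hf E hE).2
  refine ⟨fun s hs => ?_, hmain⟩
  obtain ⟨hinj, h0, σ, hσ, hu⟩ := hbr s hs
  refine ⟨⟨fun hiso => ?_, ?_⟩, ?_, tendsto_sq_div_two_mul h hσ hu⟩
  · obtain ⟨f, hfa, hf⟩ := hmain hiso
    exact ⟨f, hfa 0 ⟨le_rfl, hwell.energy_pos⟩, eventually_of_mem (Ioo_mem_nhdsGT hwell.energy_pos)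
      (hf s hs)⟩
  · rintro ⟨f, hf, hode⟩
    exact h.isochronousCenter_iff.2 (h.odd_part_eq_of_solvesODEAt hσ hf hu hode)
  · have := involutionOfPotential_potential (g := g) (a := a) (b := b) hinj h0
    rwa [potential_zero, involution_zero] at this
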